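/- Let $f(z)=\sum_{n\ge 0}a_nz^n$ and $g(z)=\sum_{n\ge 0}b_nz^n$ be analytic in the open unit disk $\mathbb D=\{z\in\mathbb C:|z|<1\}$, and for $0\le r<1$ write $\mathcal M_f(r)=\sum_{n\ge 0}|a_n|r^n$ and $\mathcal M_g(r)=\sum_{n\ge 0}|b_n|r^n$. Suppose that $g$ is subordinate to $f$, i.e. there is an analytic function $\phi:\mathbb D\to\mathbb C$ with $\phi(0)=0$ and $|\phi(z)|<1$ for all $z\in\mathbb D$ such that $g=f\circ\phi$ on $\mathbb D$. (i) If $m\ge 1$ is an integer such that $a_n=b_n=0$ for all $n<m$ and $a_n\ne 0$ for all $n\ge m$, then $\mathcal M_g(r)\le\mathcal M_f(r)$ for all $r\in[0,1)$ with $r\le\inf_{n\ge m}|a_{n+1}/a_n|$. (ii) If $a_n\ne 0$ for all $n\ge 0$ (the case $m=0$), then $\mathcal M_g(r)\le\mathcal M_f(r)$ for all $r\in[0,1)$ with $r\le\inf_{n\ge 1}|a_{n+1}/a_n|$. -/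

import Mathlib

/-- The `n`-th Taylor coefficient at the origin of `F : ℂ → ℂ`, i.e. `A_n` in
`F(z) = ∑ A_n z ^ n`. -/
noncomputable def taylorCoeff (F : ℂ → ℂ) (n : ℕ) : ℂ :=
  iteratedDeriv n F 0 / (n.factorial : ℂ)

/-- The majorant series `M_F(r) = ∑ |A_n| r ^ n` of `F(z) = ∑ A_n z ^ n`.
It converges for `F` analytic in the unit disk and `0 ≤ r < 1`, see `summable_majorant`. -/
noncomputable def majorant (F : ℂ → ℂ) (r : ℝ) : ℝ :=
  ∑' n : ℕ, ‖taylorCoeff F n‖ * r ^ n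

/-- `g` is subordinate to `f` in the unit disk: `g = f ∘ φ` there for some `φ` analytic in the
unit disk with `φ(0) = 0` and `|φ| < 1`. -/
def Subordinate (g f : ℂ → ℂ) : Prop :=
  ∃ φ : ℂ → ℂ, AnalyticOnNhd ℂ φ (Metric.ball 0 1) ∧ φ 0 = 0 ∧
    (∀ z ∈ Metric.ball (0 : ℂ) 1, ‖φ z‖ < 1) ∧
    ∀ z ∈ Metric.ball (0 : ℂ) 1, g z = f (φ z)

/-- A function analytic in the unit disk is the sum of the power series with coefficients
`taylorCoeff F n`. -/
theorem hasSum_taylorCoeff {F : ℂ → ℂ} (hF : AnalyticOnNhd ℂ F (Metric.ball 0 1))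
    {z : ℂ} (hz : z ∈ Metric.ball (0 : ℂ) 1) :
    HasSum (fun n : ℕ => taylorCoeff F n * z ^ n) (F z) := by
  have h := Complex.hasSum_taylorSeries_on_ball hF.differentiableOn hz
  have e : (fun n : ℕ => taylorCoeff F n * z ^ n) =
      fun n : ℕ => ((n.factorial : ℂ)⁻¹) • (z - 0) ^ n • iteratedDeriv n F 0 := by
    funext n
    simp only [taylorCoeff, sub_zero, smul_eq_mul]
    ring
  rw [e]
  exact h

/-- The majorant series of a function analytic in the unit disk converges on `[0, 1)`. -/
theorem summable_majorant {F : ℂ → ℂ} (hF : AnalyticOnNhd ℂ F (Metric.ball 0 1))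
    {r : ℝ} (h0 : 0 ≤ r) (h1 : r < 1) :
    Summable (fun n : ℕ => ‖taylorCoeff F n‖ * r ^ n) := by
  have hz : (r : ℂ) ∈ Metric.ball (0 : ℂ) 1 := by
    simpa [abs_of_nonneg h0] using h1
  have h := (hasSum_taylorCoeff hF hz).summable.norm
  simpa [abs_of_nonneg h0] using h

/-! Rogosinski's inequality `∑_{n<N} |b_n|² ≤ ∑_{n<N} |a_n|²` does the analytic work. The first `N`
coefficients of `g` are those of `P ∘ φ`, with `P` the truncation of `f`. Bessel bounds their square
sum by the mean of `|P ∘ φ|²` on a circle, and Littlewood bounds that mean by `∑_{n<N} |a_n|²`.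

The bound on `r` says exactly that `r^n / |a_n|` is nonincreasing for `n ≥ m`. Abel summation with
these weights gives a nonnegative sum of `r^n (|a_n| - |b_n|² / |a_n|)`, and `2|b_n| ≤ |a_n| +
|b_n|² / |a_n|` makes the comparison linear. -/

open Metric Real in
/-- Pythagoras on circles: a holomorphic function vanishing at the centre is orthogonal to the
constants. -/
theorem circleAverage_norm_sq_const_add {G : ℂ → ℂ} {ρ : ℝ} (hρ : 0 ≤ ρ)
    (hG : DifferentiableOn ℂ G (closedBall 0 ρ)) (h0 : G 0 = 0) (a : ℂ) :
    circleAverage (fun z => ‖a + G z‖ ^ 2) 0 ρ =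
      ‖a‖ ^ 2 + circleAverage (fun z => ‖G z‖ ^ 2) 0 ρ := by
  have hc : ContinuousOn G (sphere 0 ρ) := hG.continuousOn.mono sphere_subset_closedBall
  -- The cross term of `‖a + G z‖ ^ 2`; its mean vanishes by the mean value property.
  let L : ℂ →L[ℝ] ℝ := 2 • innerSL ℝ a
  have hGi : CircleIntegrable G 0 ρ := hc.circleIntegrable hρ
  have hL : circleAverage (fun z => L (G z)) 0 ρ = 0 := by
    have h1 : circleAverage (L ∘ G) 0 ρ = L (circleAverage G 0 ρ) := L.circleAverage_comp_comm hGi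
    have h2 : circleAverage G 0 ρ = G 0 := by
      apply DiffContOnCl.circleAverage
      rw [abs_of_nonneg hρ]
      exact hG.diffContOnCl_ball subset_rfl
    rw [h2, h0, map_zero] at h1
    exact h1
  have hLi : CircleIntegrable (fun z => L (G z)) 0 ρ :=
    (L.continuous.comp_continuousOn hc).circleIntegrable hρ
  have hNi : CircleIntegrable (fun z => ‖G z‖ ^ 2) 0 ρ := (hc.norm.pow 2).circleIntegrable hρ
  have hCi : CircleIntegrable (fun _ => ‖a‖ ^ 2) (0 : ℂ) ρ := circleIntegrable_const _ _ _
  have e : (fun z => ‖a + G z‖ ^ 2) = fun z => (‖a‖ ^ 2 + L (G z)) + ‖G z‖ ^ 2 := by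
    funext z
    rw [norm_add_sq_real]
    simp [L, mul_add]
  rw [e, circleAverage_fun_add (f₁ := fun z => ‖a‖ ^ 2 + L (G z)) (hCi.add hLi) hNi, circleAverage_fun_add hCi hLi, hL,
    circleAverage_const, add_zero]

/-! ### Taylor coefficients and divided differences -/

theorem taylorCoeff_zero (F : ℂ → ℂ) : taylorCoeff F 0 = F 0 := by
  simp [taylorCoeff]

theorem taylorCoeff_eq_coeff {F : ℂ → ℂ} {p : FormalMultilinearSeries ℂ ℂ ℂ}
    (h : HasFPowerSeriesAt F p 0) (n : ℕ) : taylorCoeff F n = p.coeff n := by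
  rw [h.eq_formalMultilinearSeries h.analyticAt.hasFPowerSeriesAt,
    FormalMultilinearSeries.coeff_ofScalars, taylorCoeff]

/-- Dividing out `z` shifts the coefficients, which drives the inductions that peel off a constant
term. -/
theorem taylorCoeff_succ {F : ℂ → ℂ} (hF : AnalyticAt ℂ F 0) (n : ℕ) :
    taylorCoeff F (n + 1) = taylorCoeff (dslope F 0) n := by
  obtain ⟨p, hp⟩ := hF
  rw [taylorCoeff_eq_coeff hp, taylorCoeff_eq_coeff hp.has_fpower_series_dslope_fslope,
    FormalMultilinearSeries.coeff_fslope]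

theorem differentiableOn_dslope_ball {F : ℂ → ℂ} (hF : DifferentiableOn ℂ F (Metric.ball 0 1)) :
    DifferentiableOn ℂ (dslope F 0) (Metric.ball 0 1) :=
  (Complex.differentiableOn_dslope (Metric.ball_mem_nhds _ one_pos)).2 hF

theorem analyticAt_zero_of_differentiableOn {F : ℂ → ℂ}
    (hF : DifferentiableOn ℂ F (Metric.ball 0 1)) : AnalyticAt ℂ F 0 :=
  hF.analyticAt (Metric.ball_mem_nhds _ one_pos)

theorem eq_add_mul_dslope (F : ℂ → ℂ) (z : ℂ) : F z = F 0 + z * dslope F 0 z := by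
  have h := sub_smul_dslope F 0 z
  rw [sub_zero, smul_eq_mul] at h
  rw [h]; ring

/-- Taylor's formula with the remainder expressed by an iterated divided difference. -/
theorem eq_sum_taylorCoeff_add {F : ℂ → ℂ} (hF : DifferentiableOn ℂ F (Metric.ball 0 1))
    (N : ℕ) (z : ℂ) :
    F z = ∑ k ∈ Finset.range N, taylorCoeff F k * z ^ k +
      z ^ N * ((fun G => dslope G 0)^[N] F) z := by
  induction N generalizing F with
  | zero => simp
  | succ N ih =>
    rw [Finset.sum_range_succ', Function.iterate_succ_apply, eq_add_mul_dslope F z,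
      ih (differentiableOn_dslope_ball hF), taylorCoeff_zero, mul_add, Finset.mul_sum]
    simp only [taylorCoeff_succ (analyticAt_zero_of_differentiableOn hF), pow_succ, pow_zero]
    rw [Finset.sum_congr rfl fun k _ => mul_left_comm z _ _]
    simp only [mul_comm z]
    ring

/-! ### Mean squares on circles and Rogosinski's inequality -/

open Real in
/-- Bessel's inequality on the circle of radius `ρ`. -/
theorem sum_sq_taylorCoeff_le_circleAverage {ρ : ℝ} (h0 : 0 ≤ ρ) (h1 : ρ < 1) (N : ℕ)
    {F : ℂ → ℂ} (hF : DifferentiableOn ℂ F (Metric.ball 0 1)) :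
    ∑ k ∈ Finset.range N, ‖taylorCoeff F k‖ ^ 2 * (ρ ^ 2) ^ k ≤
      circleAverage (fun z => ‖F z‖ ^ 2) 0 ρ := by
  induction N generalizing F with
  | zero =>
    simp only [Finset.range_zero, Finset.sum_empty]
    exact circleAverage_nonneg_of_nonneg fun z _ => by positivity
  | succ N ih =>
    have hD := differentiableOn_dslope_ball hF
    have hsub : Metric.closedBall (0 : ℂ) ρ ⊆ Metric.ball 0 1 := Metric.closedBall_subset_ball h1
    have e : circleAverage (fun z => ‖F z‖ ^ 2) 0 ρ =
        ‖F 0‖ ^ 2 + ρ ^ 2 * circleAverage (fun z => ‖dslope F 0 z‖ ^ 2) 0 ρ := by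
      have h2 := circleAverage_norm_sq_const_add h0 (G := fun z => z * dslope F 0 z)
        (differentiableOn_id.mul (hD.mono hsub)) (by simp) (F 0)
      simp only [← eq_add_mul_dslope] at h2
      rw [h2, ← smul_eq_mul (ρ ^ 2), ← circleAverage_fun_smul]
      congr 1
      apply circleAverage_congr_sphere
      intro z hz
      rw [abs_of_nonneg h0, mem_sphere_zero_iff_norm] at hz
      simp [hz, mul_pow]
    rw [Finset.sum_range_succ', e, taylorCoeff_zero, pow_zero, mul_one, add_comm]
    gcongr
    refine le_trans (le_of_eq ?_) (mul_le_mul_of_nonneg_left (ih hD) (by positivity))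
    rw [Finset.mul_sum]
    refine Finset.sum_congr rfl fun k _ => ?_
    rw [taylorCoeff_succ (analyticAt_zero_of_differentiableOn hF), pow_succ]
    ring

open Real in
/-- Littlewood's inequality for polynomials. -/
theorem circleAverage_norm_sq_polynomial_comp_le {φ : ℂ → ℂ}
    (hφ : DifferentiableOn ℂ φ (Metric.ball 0 1)) (hφ0 : φ 0 = 0)
    (hφ1 : ∀ z ∈ Metric.ball (0 : ℂ) 1, ‖φ z‖ < 1)
    {ρ : ℝ} (h0 : 0 ≤ ρ) (h1 : ρ < 1) (N : ℕ) (a : ℕ → ℂ) :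
    circleAverage (fun z => ‖∑ k ∈ Finset.range N, a k * φ z ^ k‖ ^ 2) 0 ρ ≤
      ∑ k ∈ Finset.range N, ‖a k‖ ^ 2 := by
  induction N generalizing a with
  | zero => simp [circleAverage_const]
  | succ N ih =>
    have hsub : Metric.closedBall (0 : ℂ) ρ ⊆ Metric.ball 0 1 := Metric.closedBall_subset_ball h1
    have hφ' := hφ.mono hsub
    have hT : DifferentiableOn ℂ (fun z => ∑ k ∈ Finset.range N, a (k + 1) * φ z ^ k)
        (Metric.closedBall 0 ρ) := by fun_prop
    have hφT : DifferentiableOn ℂ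
        (fun z => φ z * ∑ k ∈ Finset.range N, a (k + 1) * φ z ^ k)
        (Metric.closedBall 0 ρ) := hφ'.mul hT
    have e : ∀ z, ∑ k ∈ Finset.range (N + 1), a k * φ z ^ k =
        a 0 + φ z * ∑ k ∈ Finset.range N, a (k + 1) * φ z ^ k := by
      intro z
      rw [Finset.sum_range_succ', Finset.mul_sum, add_comm, pow_zero, mul_one]
      congr 1
      exact Finset.sum_congr rfl fun k _ => by ring
    simp only [e]
    rw [circleAverage_norm_sq_const_add h0 hφT (by simp [hφ0]),
      Finset.sum_range_succ', add_comm]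
    gcongr
    -- The factor `φ` is dropped using `|φ| ≤ 1`; the shifted polynomial remains.
    refine le_trans (circleAverage_mono ?_ ?_ ?_) (ih fun k => a (k + 1))
    · exact ((hφT.continuousOn.norm.pow 2).mono
        Metric.sphere_subset_closedBall).circleIntegrable h0
    · exact ((hT.continuousOn.norm.pow 2).mono
        Metric.sphere_subset_closedBall).circleIntegrable h0
    · intro z hz
      rw [abs_of_nonneg h0] at hz
      have hz1 := (hφ1 z (hsub (Metric.sphere_subset_closedBall hz))).le
      rw [norm_mul]
      gcongr
      exact mul_le_of_le_one_left (norm_nonneg _) hz1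

/-- The first `N` Taylor coefficients of `f ∘ φ` only depend on those of `f`. -/
theorem taylorCoeff_comp_eq {f g φ : ℂ → ℂ} (hf : DifferentiableOn ℂ f (Metric.ball 0 1))
    (hφ : DifferentiableOn ℂ φ (Metric.ball 0 1)) (hφ0 : φ 0 = 0)
    (hg : DifferentiableOn ℂ g (Metric.ball 0 1))
    (hgf : ∀ z ∈ Metric.ball (0 : ℂ) 1, g z = f (φ z)) {N n : ℕ} (hn : n < N) :
    taylorCoeff g n =
      taylorCoeff (fun z => ∑ k ∈ Finset.range N, taylorCoeff f k * φ z ^ k) n := by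
  have hφa := analyticAt_zero_of_differentiableOn hφ
  have hga := analyticAt_zero_of_differentiableOn hg
  set S : ℂ → ℂ := fun z => ∑ k ∈ Finset.range N, taylorCoeff f k * φ z ^ k with hS
  have hSa : AnalyticAt ℂ S 0 := by fun_prop
  have hR : ∀ M, DifferentiableOn ℂ ((fun G => dslope G 0)^[M] f) (Metric.ball 0 1) := by
    intro M
    induction M with
    | zero => exact hf
    | succ M ih =>
      rw [Function.iterate_succ_apply']
      exact differentiableOn_dslope_ball ih
  have hRa : AnalyticAt ℂ ((fun G => dslope G 0)^[N] f) (φ 0) := by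
    rw [hφ0]; exact analyticAt_zero_of_differentiableOn (hR N)
  have hda := analyticAt_zero_of_differentiableOn (differentiableOn_dslope_ball hφ)
  -- `g - S` is `φ ^ N` times an analytic function, and `φ` is divisible by `z`.
  have hord : (N : ℕ∞) ≤ analyticOrderAt (g - S) 0 := by
    rw [natCast_le_analyticOrderAt (hga.sub hSa)]
    refine ⟨fun z => dslope φ 0 z ^ N * ((fun G => dslope G 0)^[N] f) (φ z),
      (hda.pow N).mul (hRa.comp hφa), ?_⟩
    filter_upwards [Metric.ball_mem_nhds (0 : ℂ) one_pos] with z hz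
    have h1 := eq_sum_taylorCoeff_add hf N (φ z)
    have h2 := eq_add_mul_dslope φ z
    rw [hφ0, zero_add] at h2
    rw [Pi.sub_apply, hgf z hz, h1, add_sub_cancel_left, sub_zero, smul_eq_mul, ← mul_assoc,
      ← mul_pow, ← h2]
  rw [natCast_le_analyticOrderAt_iff_iteratedDeriv_eq_zero (hga.sub hSa)] at hord
  have h := hord n hn
  rw [iteratedDeriv_sub hga.contDiffAt hSa.contDiffAt, sub_eq_zero] at h
  rw [taylorCoeff, taylorCoeff, h]

/-- **Rogosinski's theorem** on the coefficients of subordinate functions. -/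
theorem Subordinate.sum_sq_taylorCoeff_le {f g : ℂ → ℂ}
    (hf : AnalyticOnNhd ℂ f (Metric.ball 0 1)) (hg : AnalyticOnNhd ℂ g (Metric.ball 0 1))
    (hgf : Subordinate g f) (N : ℕ) :
    ∑ k ∈ Finset.range N, ‖taylorCoeff g k‖ ^ 2 ≤
      ∑ k ∈ Finset.range N, ‖taylorCoeff f k‖ ^ 2 := by
  obtain ⟨φ, hφ, hφ0, hφ1, h⟩ := hgf
  have hφd := hφ.differentiableOn
  have key : ∀ ρ : ℝ, 0 ≤ ρ → ρ < 1 →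
      ∑ k ∈ Finset.range N, ‖taylorCoeff g k‖ ^ 2 * (ρ ^ 2) ^ k ≤
        ∑ k ∈ Finset.range N, ‖taylorCoeff f k‖ ^ 2 := by
    intro ρ h0 h1
    rw [Finset.sum_congr rfl fun k hk => by
      rw [taylorCoeff_comp_eq hf.differentiableOn hφd hφ0 hg.differentiableOn h
        (Finset.mem_range.1 hk)]]
    exact (sum_sq_taylorCoeff_le_circleAverage h0 h1 N (by fun_prop)).trans
      (circleAverage_norm_sq_polynomial_comp_le hφd hφ0 hφ1 h0 h1 N _)
  have hlim : Filter.Tendsto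
      (fun ρ : ℝ => ∑ k ∈ Finset.range N, ‖taylorCoeff g k‖ ^ 2 * (ρ ^ 2) ^ k)
      (nhdsWithin 1 (Set.Iio 1)) (nhds (∑ k ∈ Finset.range N, ‖taylorCoeff g k‖ ^ 2)) := by
    have hc : Continuous
        (fun ρ : ℝ => ∑ k ∈ Finset.range N, ‖taylorCoeff g k‖ ^ 2 * (ρ ^ 2) ^ k) := by fun_prop
    have := hc.tendsto 1
    simp only [one_pow, mul_one] at this
    exact this.mono_left nhdsWithin_le_nhds
  refine le_of_tendsto hlim ?_
  filter_upwards [Ioo_mem_nhdsLT (zero_lt_one (α := ℝ))] with ρ hρ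
  exact key ρ hρ.1.le hρ.2

/-! ### From square sums to majorant series -/

/-- Abel summation: antitone nonnegative weights preserve nonnegativity of partial sums. -/
theorem sum_antitone_mul_nonneg {l d : ℕ → ℝ} (hl : Antitone l) (hl0 : ∀ n, 0 ≤ l n)
    (hd : ∀ N, 0 ≤ ∑ n ∈ Finset.range N, d n) (N : ℕ) :
    0 ≤ ∑ n ∈ Finset.range N, l n * d n := by
  -- Strengthened so that the induction closes: lowering the weight shrinks a nonnegative partial
  -- sum.
  have key : ∀ N, l N * ∑ n ∈ Finset.range (N + 1), d n ≤
      ∑ n ∈ Finset.range (N + 1), l n * d n := by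
    intro N
    induction N with
    | zero => simp
    | succ N ih =>
      rw [Finset.sum_range_succ, Finset.sum_range_succ (fun n => l n * d n), mul_add]
      gcongr
      exact (mul_le_mul_of_nonneg_right (hl N.le_succ) (hd _)).trans ih
  cases N with
  | zero => simp
  | succ N => exact (mul_nonneg (hl0 N) (hd _)).trans (key N)

theorem sum_mul_pow_le_of_sum_sq_le {a b : ℕ → ℝ} (ha : ∀ n, 0 ≤ a n) {m : ℕ}
    (hm : ∀ n ≥ m, a n ≠ 0) (hab : ∀ n < m, b n = a n)
    (hsq : ∀ N, ∑ n ∈ Finset.range N, b n ^ 2 ≤ ∑ n ∈ Finset.range N, a n ^ 2)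
    {r : ℝ} (hr : 0 ≤ r) (hra : ∀ n ≥ m, r ≤ a (n + 1) / a n) (N : ℕ) :
    ∑ n ∈ Finset.range N, b n * r ^ n ≤ ∑ n ∈ Finset.range N, a n * r ^ n := by
  have hpos : ∀ n ≥ m, 0 < a n := fun n hn => (ha n).lt_of_ne' (hm n hn)
  -- Frozen below `m`, where `a` may vanish; those weights multiply `a n ^ 2 - b n ^ 2 = 0`.
  let l : ℕ → ℝ := fun n => r ^ max n m / a (max n m)
  have hl0 : ∀ n, 0 ≤ l n := fun n => div_nonneg (pow_nonneg hr _) (ha _)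
  have hl : Antitone l := by
    refine antitone_nat_of_succ_le fun n => ?_
    rcases lt_or_ge n m with h | h
    · simp only [l, max_eq_right h.le, max_eq_right (Nat.succ_le_of_lt h), le_refl]
    · simp only [l, max_eq_left h, max_eq_left (h.trans n.le_succ)]
      have h1 := hpos n h
      have h2 := hpos (n + 1) (h.trans n.le_succ)
      have h3 := hra n h
      rw [le_div_iff₀ h1] at h3
      rw [div_le_div_iff₀ h2 h1, pow_succ, mul_assoc]
      gcongr
  have habel := sum_antitone_mul_nonneg (d := fun n => a n ^ 2 - b n ^ 2) hl hl0
    (fun M => by rw [Finset.sum_sub_distrib]; exact sub_nonneg.2 (hsq M)) N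
  have hterm : ∀ n, b n * r ^ n ≤ a n * r ^ n - l n * (a n ^ 2 - b n ^ 2) / 2 := by
    intro n
    rcases lt_or_ge n m with h | h
    · simp [hab n h]
    · have h1 := hpos n h
      have h2 : l n * (a n ^ 2 - b n ^ 2) = r ^ n * (a n - b n ^ 2 / a n) := by
        simp only [l, max_eq_left h]
        field_simp
      have h3 : 2 * b n ≤ a n + b n ^ 2 / a n := by
        have : a n + b n ^ 2 / a n - 2 * b n = (a n - b n) ^ 2 / a n := by
          field_simp
          ring
        have : 0 ≤ (a n - b n) ^ 2 / a n := by positivity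
        linarith
      rw [h2]
      nlinarith [mul_le_mul_of_nonneg_left h3 (pow_nonneg hr n)]
  calc ∑ n ∈ Finset.range N, b n * r ^ n
      ≤ ∑ n ∈ Finset.range N, (a n * r ^ n - l n * (a n ^ 2 - b n ^ 2) / 2) :=
        Finset.sum_le_sum fun n _ => hterm n
    _ = ∑ n ∈ Finset.range N, a n * r ^ n -
          (∑ n ∈ Finset.range N, l n * (a n ^ 2 - b n ^ 2)) / 2 := by
        rw [Finset.sum_sub_distrib, Finset.sum_div]
    _ ≤ ∑ n ∈ Finset.range N, a n * r ^ n := by linarith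

/-- Requiring only agreement below `m` covers both parts of the theorem. -/
theorem Subordinate.majorant_le {f g : ℂ → ℂ}
    (hf : AnalyticOnNhd ℂ f (Metric.ball 0 1)) (hg : AnalyticOnNhd ℂ g (Metric.ball 0 1))
    (hgf : Subordinate g f) {m : ℕ} (hfg : ∀ n < m, taylorCoeff g n = taylorCoeff f n)
    (hm : ∀ n ≥ m, taylorCoeff f n ≠ 0) {r : ℝ} (h0 : 0 ≤ r) (h1 : r < 1)
    (hr : r ≤ ⨅ n : Set.Ici m, ‖taylorCoeff f ((n : ℕ) + 1) / taylorCoeff f (n : ℕ)‖) :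
    majorant g r ≤ majorant f r := by
  refine (summable_majorant hg h0 h1).tsum_le_of_sum_range_le fun N => ?_
  refine le_trans ?_ ((summable_majorant hf h0 h1).sum_le_tsum (Finset.range N)
    fun n _ => by positivity)
  refine sum_mul_pow_le_of_sum_sq_le (fun n => norm_nonneg _)
    (fun n hn => norm_ne_zero_iff.2 (hm n hn)) (fun n hn => by rw [hfg n hn])
    (hgf.sum_sq_taylorCoeff_le hf hg) h0 (fun n hn => ?_) N
  rw [← norm_div]
  exact hr.trans (ciInf_le ⟨0, by rintro _ ⟨k, rfl⟩; exact norm_nonneg _⟩ (⟨n, hn⟩ : Set.Ici m))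

theorem mainTheorem5 (f g : ℂ → ℂ)
    (hf : AnalyticOnNhd ℂ f (Metric.ball 0 1))
    (hg : AnalyticOnNhd ℂ g (Metric.ball 0 1))
    (hgf : Subordinate g f) :
    (∀ m : ℕ, 1 ≤ m →
      (∀ n < m, taylorCoeff f n = 0) → (∀ n < m, taylorCoeff g n = 0) →
      (∀ n ≥ m, taylorCoeff f n ≠ 0) →
      ∀ r : ℝ, 0 ≤ r → r < 1 →
        r ≤ ⨅ n : Set.Ici m, ‖taylorCoeff f ((n : ℕ) + 1) / taylorCoeff f (n : ℕ)‖ →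
        majorant g r ≤ majorant f r) ∧
    ((∀ n, taylorCoeff f n ≠ 0) →
      ∀ r : ℝ, 0 ≤ r → r < 1 →
        r ≤ ⨅ n : Set.Ici (1 : ℕ), ‖taylorCoeff f ((n : ℕ) + 1) / taylorCoeff f (n : ℕ)‖ →
        majorant g r ≤ majorant f r) := by
  refine ⟨fun m _ hf0 hg0 hm r h0 h1 hr => ?_, fun hne r h0 h1 hr => ?_⟩
  · exact hgf.majorant_le hf hg (fun n hn => (hg0 n hn).trans (hf0 n hn).symm) hm h0 h1 hr
  -- Applied with `m = 1`: `φ 0 = 0` forces equal constant terms.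
  · refine hgf.majorant_le hf hg (fun n hn => ?_) (fun n _ => hne n) h0 h1 hr
    obtain ⟨φ, -, hφ0, -, h⟩ := hgf
    rw [Nat.lt_one_iff.1 hn, taylorCoeff_zero, taylorCoeff_zero,
      h 0 (Metric.mem_ball_self one_pos), hφ0]
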